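/- Let $F$ be a field of characteristic different from two, and let $p$ and $q$ be anisotropic quadratic forms over $F$ on finite-dimensional vector spaces, with $\dim p=n\geq 1$. Write $p\subseteq q$ if $q\simeq p\perp r$ for some non-degenerate quadratic form $r$ over $F$ (possibly of dimension zero). For a field extension $K/F$, let $D_K(p)$ denote the set of values in $K^{\times}$ represented by the extension $p_K$ of $p$ to $K$. Fix coordinates on the space of $p$, so that $p(x_1,\ldots,x_n)$ is a homogeneous polynomial of degree two over $F$. Let $F(\!(x)\!)$ be the field of Laurent series in the variable $x$ over $F$. The form $p\perp\langle -x\rangle$ over $F(\!(x)\!)$ is anisotropic of dimension $n+1\geq 2$; let $F(\!(x)\!)(p\perp\langle -x\rangle)$ denote its function field, that is, the fraction field of the integral domain $F(\!(x)\!)[X_1,\ldots,X_{n+1}]/\bigl(p(X_1,\ldots,X_n)-xX_{n+1}^2\bigr)$. Then the following are equivalent: (i) $p\subseteq q$; (ii) $D_K(p)\subseteq D_K(q)$ for every field extension $K/F$; (iii) $p(x_1,\ldots,x_n)\in D_{F(x_1,\ldots,x_n)}(q)$, where $F(x_1,\ldots,x_n)$ is the rational function field in $n$ variables over $F$; (iv)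 $q\perp\langle -x\rangle$ is isotropic over $F(\!(x)\!)(p\perp\langle -x\rangle)$, that is, it represents zero non-trivially there. -/

import Mathlib

open scoped TensorProduct LaurentSeries

universe u v w t

noncomputable section

namespace QuadForms

section CommRing

variable {K : Type u} [CommRing K] {V : Type v} [AddCommGroup V] [Module K V]

/-- A quadratic form is isotropic if it represents zero non-trivially. -/
def IsIsotropic (φ : QuadraticForm K V) : Prop :=
  ∃ v : V, v ≠ 0 ∧ φ v = 0

/-- `D_K(φ)`: the set of non-zero values represented by `φ`. -/
def representedValues (φ : QuadraticForm K V) : Set K :=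
  {a | a ≠ 0 ∧ ∃ v : V, φ v = a}

/-- The one-dimensional form `⟨a⟩ : y ↦ a y ^ 2`. -/
def oneDim (a : K) : QuadraticForm K K :=
  a • QuadraticMap.sq

/-- The polynomial `φ(X) = φ(∑ i, X i • b i)` which describes `φ` in the coordinates given by a
basis `b` (it is the value of `φ`, extended to the polynomial ring, at the generic vector). -/
def toPolynomial [Invertible (2 : K)] {ι : Type w} [Fintype ι] (φ : QuadraticForm K V)
    (b : Module.Basis ι K V) : MvPolynomial ι K :=
  φ.baseChange (MvPolynomial ι K) (∑ i, (MvPolynomial.X i : MvPolynomial ι K) ⊗ₜ[K] b i)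

theorem toPolynomial_eq [Invertible (2 : K)] {ι : Type w} [Fintype ι] (φ : QuadraticForm K V)
    (b : Module.Basis ι K V) :
    toPolynomial φ b = ∑ i, ∑ j, MvPolynomial.C (QuadraticMap.associated φ (b i) (b j)) *
      (MvPolynomial.X i * MvPolynomial.X j) := by
  let inst : Invertible (2 : MvPolynomial ι K) :=
    (Invertible.map (algebraMap K (MvPolynomial ι K)) 2).copy 2 (map_ofNat _ _).symm
  unfold toPolynomial
  rw [← QuadraticMap.associated_eq_self_apply (MvPolynomial ι K)
    (φ.baseChange (MvPolynomial ι K)), QuadraticForm.associated_baseChange]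
  simp only [map_sum, LinearMap.sum_apply, LinearMap.BilinForm.baseChange_tmul]
  rw [Finset.sum_comm]
  refine Finset.sum_congr rfl fun i _ => Finset.sum_congr rfl fun j _ => ?_
  rw [MvPolynomial.smul_eq_C_mul]

theorem eval_toPolynomial [Invertible (2 : K)] {ι : Type w} [Fintype ι] (φ : QuadraticForm K V)
    (b : Module.Basis ι K V) (c : ι → K) :
    MvPolynomial.eval c (toPolynomial φ b) = φ (∑ i, c i • b i) := by
  rw [toPolynomial_eq, ← QuadraticMap.associated_eq_self_apply K φ]
  simp only [map_sum, LinearMap.sum_apply, map_smul, LinearMap.smul_apply, map_mul,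
    MvPolynomial.eval_C, MvPolynomial.eval_X, smul_eq_mul]
  rw [Finset.sum_comm]
  refine Finset.sum_congr rfl fun i _ => ?_
  rw [Finset.mul_sum]
  refine Finset.sum_congr rfl fun j _ => ?_
  change QuadraticMap.associated φ (b j) (b i) * _ = _ * (_ * QuadraticMap.associated φ (b j) (b i))
  ring

theorem isHomogeneous_toPolynomial [Invertible (2 : K)] {ι : Type w} [Fintype ι]
    (φ : QuadraticForm K V) (b : Module.Basis ι K V) : (toPolynomial φ b).IsHomogeneous 2 := by
  rw [toPolynomial_eq]
  refine MvPolynomial.IsHomogeneous.sum _ _ _ fun i _ =>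
    MvPolynomial.IsHomogeneous.sum _ _ _ fun j _ => ?_
  simpa using (MvPolynomial.isHomogeneous_C ι _).mul
    ((MvPolynomial.isHomogeneous_X K i).mul (MvPolynomial.isHomogeneous_X K j))

/-- The function field `K(φ)` of the affine quadric `φ(X) = 0`, that is, the fraction field of
`K[X] / (φ(X))`. The ideal `(φ(X))` is prime for every anisotropic form `φ` of dimension at least
two over a field `K`, see `isPrime_span_toPolynomial`. -/
abbrev FunctionField [Invertible (2 : K)] {ι : Type w} [Fintype ι] (φ : QuadraticForm K V)
    (b : Module.Basis ι K V) : Type (max u w) :=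
  FractionRing (MvPolynomial ι K ⧸ Ideal.span {toPolynomial φ b})

end CommRing

section Prime

variable {K : Type u} [Field K] {V : Type v} [AddCommGroup V] [Module K V]

theorem exists_eval_eq_add_of_totalDegree_eq_one {ι : Type w} {g : MvPolynomial ι K}
    (hg : g.totalDegree = 1) :
    ∃ (c : K) (l : (ι → K) →ₗ[K] K), ∀ y, MvPolynomial.eval y g = c + l y := by
  have h1 : ∀ h ∈ MvPolynomial.homogeneousSubmodule ι K 1,
      ∃ l : (ι → K) →ₗ[K] K, ∀ y, MvPolynomial.eval y h = l y := by
    intro h hh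
    rw [MvPolynomial.homogeneousSubmodule_one_eq_span_X] at hh
    induction hh using Submodule.span_induction with
    | mem x hx =>
      obtain ⟨i, rfl⟩ := hx
      exact ⟨LinearMap.proj i, fun y => by simp⟩
    | zero => exact ⟨0, fun y => by simp⟩
    | add x y _ _ hx hy =>
      obtain ⟨l, hl⟩ := hx
      obtain ⟨l', hl'⟩ := hy
      exact ⟨l + l', fun y => by simp [hl, hl']⟩
    | smul a x _ hx =>
      obtain ⟨l, hl⟩ := hx
      exact ⟨a • l, fun y => by simp [hl]⟩
  obtain ⟨l, hl⟩ := h1 _ (MvPolynomial.homogeneousComponent_mem 1 g)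
  refine ⟨MvPolynomial.coeff 0 g, l, fun y => ?_⟩
  conv_lhs => rw [← MvPolynomial.sum_homogeneousComponent g, hg]
  simp [Finset.sum_range_succ, hl, MvPolynomial.homogeneousComponent_zero]

theorem isPrime_span_toPolynomial [Invertible (2 : K)] {ι : Type w} [Fintype ι] [Nontrivial ι]
    (φ : QuadraticForm K V) (b : Module.Basis ι K V) (hφ : φ.Anisotropic) :
    (Ideal.span {toPolynomial φ b}).IsPrime := by
  have hzero : ∀ y : ι → K, MvPolynomial.eval y (toPolynomial φ b) = 0 → y = 0 := by
    intro y hy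
    rw [eval_toPolynomial] at hy
    have h := hφ _ hy
    funext i
    exact Fintype.linearIndependent_iff.mp b.linearIndependent y h i
  have hne : toPolynomial φ b ≠ 0 := by
    intro h
    have h1 := hzero 1 (by rw [h, map_zero])
    obtain ⟨i, -⟩ := exists_pair_ne ι
    exact one_ne_zero (congrFun h1 i)
  have hdeg := (isHomogeneous_toPolynomial φ b).totalDegree hne
  have hunit : ∀ g : MvPolynomial ι K, g ≠ 0 → g.totalDegree = 0 → IsUnit g := by
    intro g hg h
    rw [MvPolynomial.totalDegree_eq_zero_iff_eq_C.mp h] at hg ⊢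
    refine IsUnit.map _ (isUnit_iff_ne_zero.mpr fun h0 => hg ?_)
    rw [h0, map_zero]
  have hirr : Irreducible (toPolynomial φ b) := by
    refine ⟨fun h => ?_, fun g h hgh => ?_⟩
    · have := (MvPolynomial.isUnit_iff_totalDegree_of_isReduced.mp h).2
      omega
    · have hg0 : g ≠ 0 := by rintro rfl; exact hne (by rw [hgh, zero_mul])
      have hh0 : h ≠ 0 := by rintro rfl; exact hne (by rw [hgh, mul_zero])
      rw [hgh, MvPolynomial.totalDegree_mul_of_isDomain hg0 hh0] at hdeg
      by_cases hg1 : g.totalDegree = 0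
      · exact Or.inl (hunit g hg0 hg1)
      by_cases hh1 : h.totalDegree = 0
      · exact Or.inr (hunit h hh0 hh1)
      exfalso
      obtain ⟨c, l, hl⟩ := exists_eval_eq_add_of_totalDegree_eq_one
        (show g.totalDegree = 1 by omega)
      obtain ⟨c', l', hl'⟩ := exists_eval_eq_add_of_totalDegree_eq_one
        (show h.totalDegree = 1 by omega)
      have hker : LinearMap.ker l ≠ ⊥ := by
        apply LinearMap.ker_ne_bot_of_finrank_lt
        simpa using Fintype.one_lt_card (α := ι)
      obtain ⟨y, hy, hy0⟩ := (Submodule.ne_bot_iff _).mp hker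
      refine hy0 (hzero y ?_)
      rw [LinearMap.mem_ker] at hy
      have e0 : MvPolynomial.eval 0 (toPolynomial φ b) = 0 := by
        rw [eval_toPolynomial]; simp
      have e1 : MvPolynomial.eval (-y) (toPolynomial φ b) =
          MvPolynomial.eval y (toPolynomial φ b) := by
        rw [eval_toPolynomial, eval_toPolynomial]
        simp only [Pi.neg_apply, neg_smul, Finset.sum_neg_distrib, QuadraticMap.map_neg]
      rw [hgh] at e0 e1 ⊢
      simp only [map_mul, hl, hl', map_zero, map_neg, hy] at e0 e1 ⊢
      have h2 : (2 : K) ≠ 0 := (isUnit_of_invertible (2 : K)).ne_zero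
      apply mul_left_cancel₀ h2
      linear_combination 2 * e0 - e1
  exact (Ideal.span_singleton_prime hne).mpr hirr.prime

end Prime

section Field

variable {F : Type u} [Field F]

/-- `p ⊆ q`: there is a non-degenerate form `r`, possibly of dimension zero, such that
`q ≃ p ⊥ r`. -/
def IsSubform {V : Type v} [AddCommGroup V] [Module F V] {W : Type w} [AddCommGroup W] [Module F W]
    (p : QuadraticForm F V) (q : QuadraticForm F W) : Prop :=
  ∃ (m : ℕ) (r : QuadraticForm F (Fin m → F)), r.Nondegenerate ∧
    QuadraticMap.Equivalent q (p.prod r)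

instance invertibleTwoLaurent [Invertible (2 : F)] : Invertible (2 : F⸨X⸩) :=
  (Invertible.map (algebraMap F F⸨X⸩) 2).copy 2 (map_ofNat _ _).symm

/-- The variable `x` of the Laurent series field `F((x))`. -/
def laurentVar (F : Type u) [Field F] : F⸨X⸩ :=
  HahnSeries.single 1 1

/-- The form `φ_K ⊥ ⟨a⟩` over an extension `K` of `F`, for a form `φ` over `F` and `a` in `K`. -/
def perpOneDim [Invertible (2 : F)] {V : Type v} [AddCommGroup V] [Module F V]
    (φ : QuadraticForm F V) (K : Type w) [Field K] [Algebra F K] (a : K) :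
    QuadraticForm K ((K ⊗[F] V) × K) :=
  (φ.baseChange K).prod (oneDim a)

/-- The basis of the space of `φ_K ⊥ ⟨a⟩` that comes from a basis of the space of `φ`. -/
def perpBasis {V : Type v} [AddCommGroup V] [Module F V] {ι : Type t} (b : Module.Basis ι F V)
    (K : Type w) [Field K] [Algebra F K] : Module.Basis (ι ⊕ Unit) K ((K ⊗[F] V) × K) :=
  (b.baseChange K).prod (Module.Basis.singleton Unit K)

end Field

end QuadForms

end

/-! Write P for the generic value p(x_1, ..., x_n). An isometric embedding of p into q survives
every scalar extension. It therefore yields (ii), and it carries the generic zero of p ⊥ ⟨-x⟩ to a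
zero of q ⊥ ⟨-x⟩, which is (iv). Condition (iii) is (ii) at the generic vector over the rational
function field.

From (iii) to (i) (`IsAnisotropicDiag.exists_orthogonal_of_rational`): diagonalise both forms and
induct on n. Let K be the field of rational functions in all variables but one, X, so that P = a X²
+ d with a in F and d in K. By Cassels–Pfister and a degree count, q takes the value P at a vector
v₁ X + v₀ with v₁, v₀ over K. Hence v₁ has value a, v₀ has value d, and v₁ ⊥ v₀. Anisotropic forms
stay anisotropic over rational function fields, so a is already the value of a vector e over F. A
reflection takes v₁ to e and v₀ into the complement of e. That complement then represents d, the
generic value of a form in n - 1 variables.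

From (iv) to (iii) (`exists_rational_of_isIsotropic`): x ↦ P t², X_{n+1} ↦ t⁻¹ embeds the coordinate
ring of p ⊥ ⟨-x⟩ into F(X)((t)). If q did not represent P over F(X), then q ⊥ ⟨-P⟩ would be
anisotropic there and also over F(X)((t)), where ⟨-P⟩ and ⟨-P t²⟩ are isometric. Pulling back
contradicts (iv). -/

noncomputable section

namespace QuadForms

/-! ### Anisotropic diagonal forms under ring extensions; the Cassels–Pfister theorem -/

section Diagonal

open Polynomial

/-- The diagonal form `y ↦ ∑ i, c i * y i ^ 2` is anisotropic. -/
def IsAnisotropicDiag {R : Type*} [CommRing R] {ι : Type*} [Fintype ι] (c : ι → R) : Prop :=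
  ∀ y : ι → R, ∑ i, c i * y i ^ 2 = 0 → y = 0

variable {R : Type*} [CommRing R] {ι : Type*} [Fintype ι]

theorem IsAnisotropicDiag.of_map {S : Type*} [CommRing S] {c : ι → R} (f : R →+* S)
    (hf : Function.Injective f) (h : IsAnisotropicDiag fun i => f (c i)) :
    IsAnisotropicDiag c := by
  intro y hy
  have h0 := h (fun i => f (y i)) (by
    rw [← map_zero f, ← hy, map_sum]
    simp only [map_mul, map_pow])
  funext i
  exact hf (by simpa using congrFun h0 i)

theorem IsAnisotropicDiag.fractionRing {c : ι → R} (h : IsAnisotropicDiag c)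
    (K : Type*) [CommRing K] [Algebra R K] [IsFractionRing R K] :
    IsAnisotropicDiag fun i => algebraMap R K (c i) := by
  classical
  intro y hy
  obtain ⟨s, hs⟩ := IsLocalization.exist_integer_multiples_of_finite (nonZeroDivisors R) y
  choose z hz using hs
  have hz0 : z = 0 := by
    refine h z (IsFractionRing.injective R K ?_)
    rw [map_zero, map_sum]
    calc ∑ i, algebraMap R K (c i * z i ^ 2)
        = ∑ i, (algebraMap R K s) ^ 2 * (algebraMap R K (c i) * y i ^ 2) := by
          refine Finset.sum_congr rfl fun i _ => ?_
          rw [map_mul, map_pow, hz, Algebra.smul_def]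
          ring
      _ = 0 := by rw [← Finset.mul_sum, hy, mul_zero]
  funext i
  have h1 := hz i
  rw [hz0, Pi.zero_apply, map_zero, Algebra.smul_def] at h1
  exact ((IsLocalization.map_units K s).mul_right_eq_zero).mp h1.symm

/-- Leading terms cannot cancel: if M is the largest degree among the `u i`, the coefficient of
degree 2M in the sum is the value of `c` at the vector of M-th coefficients, which is non-zero when
M > 0. -/
theorem IsAnisotropicDiag.natDegree_le {c : ι → R} (h : IsAnisotropicDiag c) {u : ι → R[X]}
    {N : ℕ} (hN : (∑ i, C (c i) * u i ^ 2).natDegree ≤ 2 * N) (i : ι) : (u i).natDegree ≤ N := by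
  set M := Finset.univ.sup fun i => (u i).natDegree with hM
  have hle : ∀ i, (u i).natDegree ≤ M := fun i =>
    Finset.le_sup (f := fun i => (u i).natDegree) (Finset.mem_univ i)
  refine (hle i).trans ?_
  by_contra! hlt
  have h0 : (fun i => (u i).coeff M) = 0 := by
    apply h
    have := coeff_eq_zero_of_natDegree_lt (hN.trans_lt (by omega : 2 * N < 2 * M))
    rw [finsetSum_coeff] at this
    rw [← this]
    refine Finset.sum_congr rfl fun i _ => ?_
    rw [coeff_C_mul, coeff_pow_of_natDegree_le (hle i)]
  obtain ⟨j, -, hj⟩ := Finset.exists_mem_eq_sup _ ⟨i, Finset.mem_univ i⟩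
    (fun i => (u i).natDegree)
  have h1 := congrFun h0 j
  simp only [Pi.zero_apply] at h1
  rw [← hM] at hj
  rw [hj] at h1
  have h2 := leadingCoeff_eq_zero.mp h1
  rw [h2, natDegree_zero] at hj
  omega

theorem IsAnisotropicDiag.polynomial {c : ι → R} (h : IsAnisotropicDiag c) :
    IsAnisotropicDiag fun i => C (c i) := by
  intro y hy
  have hd : ∀ i, y i = C ((y i).coeff 0) := fun i => by
    refine eq_C_of_natDegree_le_zero (h.natDegree_le (u := y) (N := 0) ?_ i)
    rw [hy, natDegree_zero]
  have h0 : (fun i => (y i).coeff 0) = 0 := by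
    apply h
    apply C_injective
    rw [C_0, ← hy, map_sum]
    refine Finset.sum_congr rfl fun i _ => ?_
    conv_rhs => rw [hd i]
    rw [C_mul, C_pow]
  funext i
  rw [hd i, show (y i).coeff 0 = 0 from congrFun h0 i, C_0, Pi.zero_apply]

theorem IsAnisotropicDiag.mvPolynomial {c : ι → R} (h : IsAnisotropicDiag c) (n : ℕ) :
    IsAnisotropicDiag fun i => (MvPolynomial.C (c i) : MvPolynomial (Fin n) R) := by
  induction n with
  | zero =>
    refine IsAnisotropicDiag.of_map (MvPolynomial.isEmptyAlgEquiv R (Fin 0)).toRingEquiv.toRingHom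
      (MvPolynomial.isEmptyAlgEquiv R (Fin 0)).injective ?_
    have e : ∀ r : R, (MvPolynomial.isEmptyAlgEquiv R (Fin 0)).toRingEquiv.toRingHom
        (MvPolynomial.C r) = r := 
      (MvPolynomial.isEmptyAlgEquiv R (Fin 0)).commutes
    simpa only [e] using h
  | succ n ih =>
    refine IsAnisotropicDiag.of_map (MvPolynomial.finSuccEquiv R n).toRingEquiv.toRingHom
      (MvPolynomial.finSuccEquiv R n).injective ?_
    simpa [MvPolynomial.finSuccEquiv_apply] using ih.polynomial

/-- The constant terms of a zero form a zero of `c`, so they vanish. Dividing the vector by X gives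
another zero, and the argument repeats for each coefficient. -/
theorem IsAnisotropicDiag.powerSeries {c : ι → R} (h : IsAnisotropicDiag c) :
    IsAnisotropicDiag fun i => PowerSeries.C (c i) := by
  have key : ∀ (n : ℕ) (y : ι → PowerSeries R), ∑ i, PowerSeries.C (c i) * y i ^ 2 = 0 →
      ∀ i, PowerSeries.coeff n (y i) = 0 := by
    intro n
    have hconst : ∀ y : ι → PowerSeries R, ∑ i, PowerSeries.C (c i) * y i ^ 2 = 0 →
        ∀ i, PowerSeries.constantCoeff (y i) = 0 := by
      intro y hy i
      refine congrFun (h (fun i => PowerSeries.constantCoeff (y i)) ?_) i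
      have := congrArg PowerSeries.constantCoeff hy
      simpa only [map_sum, map_mul, map_pow, map_zero, PowerSeries.constantCoeff_C] using this
    induction n with
    | zero => simpa using hconst
    | succ n ih =>
      intro y hy i
      choose z hz using fun i => PowerSeries.X_dvd_iff.mpr (hconst y hy i)
      rw [hz i, PowerSeries.coeff_succ_X_mul]
      refine ih z ?_ i
      have h2 : PowerSeries.X ^ 2 * ∑ i, PowerSeries.C (c i) * z i ^ 2 = 0 := by
        rw [← hy, Finset.mul_sum]
        refine Finset.sum_congr rfl fun i _ => ?_
        rw [hz i]
        ring
      ext k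
      have := congrArg (PowerSeries.coeff (k + 2)) h2
      rwa [PowerSeries.coeff_X_pow_mul] at this
  intro y hy
  funext i
  ext n
  exact key n y hy i

theorem IsAnisotropicDiag.laurentSeries {K : Type*} [Field K] {c : ι → K}
    (h : IsAnisotropicDiag c) : IsAnisotropicDiag fun i => (HahnSeries.C (c i) : K⸨X⸩) := by
  have := h.powerSeries.fractionRing K⸨X⸩
  simpa using this

/-- The Cassels–Pfister theorem for diagonal forms: a polynomial represented over `K(X)` is
represented over `K[X]`. -/
theorem IsAnisotropicDiag.exists_polynomial {K : Type*} [Field K] {c : ι → K}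
    (h : IsAnisotropicDiag c) {f g : K[X]} (hg : g ≠ 0) {w : ι → K[X]}
    (hw : ∑ i, C (c i) * w i ^ 2 = f * g ^ 2) :
    ∃ u : ι → K[X], ∑ i, C (c i) * u i ^ 2 = f := by
  induction hd : g.natDegree using Nat.strong_induction_on generalizing g w with
  | _ d ih =>
    set v : ι → K[X] := fun i => w i / g with hv
    set r : ι → K[X] := fun i => w i % g with hr
    have hwr : ∀ i, w i = g * v i + r i := fun i => (EuclideanDomain.div_add_mod _ _).symm
    by_cases hr0 : r = 0
    · refine ⟨v, mul_right_cancel₀ (pow_ne_zero 2 hg) ?_⟩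
      rw [← hw, Finset.sum_mul]
      refine Finset.sum_congr rfl fun i _ => ?_
      rw [hwr i, hr0, Pi.zero_apply]
      ring
    set Q := ∑ i, C (c i) * v i ^ 2 with hQ
    set B := ∑ i, C (c i) * (v i * w i) with hB
    -- The line through `w / g` and the polynomial vector `v` meets the quadric of value `f` in a
    -- second point. Its denominator is `g'` and its numerator is `(Q - f) w - 2 (B - f g) v`. Since
    -- `g * g'` is the value at the remainder `r`, it has degree below `2 * d`, and the degree of
    -- the denominator drops.
    set g' := Q * g + f * g - 2 * B with hg'
    have hgg : g * g' = ∑ i, C (c i) * r i ^ 2 := by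
      have e : ∑ i, C (c i) * r i ^ 2
          = (∑ i, C (c i) * w i ^ 2) - 2 * g * B + g ^ 2 * Q := by
        rw [hB, hQ, Finset.mul_sum, Finset.mul_sum, ← Finset.sum_sub_distrib,
          ← Finset.sum_add_distrib]
        refine Finset.sum_congr rfl fun i _ => ?_
        rw [hwr i]
        ring
      rw [e, hw, hg']
      ring
    have hne : ∑ i, C (c i) * r i ^ 2 ≠ 0 := fun h0 => hr0 (h.polynomial r h0)
    have hg'0 : g' ≠ 0 := by
      rintro h0
      rw [h0, mul_zero] at hgg
      exact hne hgg.symm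
    have hrd : ∀ i, C (c i) * r i ^ 2 ≠ 0 → (C (c i) * r i ^ 2).natDegree < 2 * d := by
      intro i hi
      have hri : r i ≠ 0 := by
        intro h0
        rw [h0] at hi
        simp at hi
      have hlt : (r i).natDegree < g.natDegree :=
        natDegree_lt_natDegree hri (EuclideanDomain.mod_lt (w i) hg)
      have := (natDegree_C_mul_le (c i) (r i ^ 2)).trans natDegree_pow_le
      omega
    -- Positivity makes the truncated bound `2 * d - 1` below meaningful, also for vanishing
    -- summands.
    have hdpos : 0 < 2 * d := by
      by_contra hd0
      apply hne
      refine Finset.sum_eq_zero fun i _ => ?_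
      by_contra hi
      have := hrd i hi
      omega
    have hsum : (∑ i, C (c i) * r i ^ 2).natDegree < 2 * d := by
      have : (∑ i, C (c i) * r i ^ 2).natDegree ≤ 2 * d - 1 := by
        refine natDegree_sum_le_of_forall_le _ _ fun i _ => ?_
        by_cases hi : C (c i) * r i ^ 2 = 0
        · rw [hi, natDegree_zero]
          omega
        · have := hrd i hi
          omega
      omega
    have hlt : g'.natDegree < d := by
      rw [← hgg, natDegree_mul hg hg'0, hd] at hsum
      omega
    refine ih _ hlt hg'0 (w := fun i => (Q - f) * w i - 2 * (B - f * g) * v i) ?_ rfl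
    have e : ∑ i, C (c i) * ((Q - f) * w i - 2 * (B - f * g) * v i) ^ 2
        = (Q - f) ^ 2 * (∑ i, C (c i) * w i ^ 2) - 4 * (Q - f) * (B - f * g) * B
          + 4 * (B - f * g) ^ 2 * Q := by
      conv_rhs => rw [hB, hQ]
      rw [← hQ, ← hB, Finset.mul_sum, Finset.mul_sum, Finset.mul_sum, ← Finset.sum_sub_distrib,
        ← Finset.sum_add_distrib]
      refine Finset.sum_congr rfl fun i _ => ?_
      ring
    rw [e, hw, hg']
    ring

end Diagonal

/-! ### The subform theorem for diagonal forms -/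

section Subform

open Polynomial

/-- If `c` is anisotropic and does not represent `a`, then `c ⊥ ⟨-a⟩` is anisotropic. -/
theorem IsAnisotropicDiag.option {K : Type*} [Field K] {ι : Type*} [Fintype ι] {c : ι → K}
    (h : IsAnisotropicDiag c) {a : K} (ha : ∀ y : ι → K, ∑ i, c i * y i ^ 2 ≠ a) :
    IsAnisotropicDiag fun o : Option ι => o.elim (-a) c := by
  intro y hy
  simp only [Fintype.sum_option, Option.elim_none, Option.elim_some] at hy
  have h0 : y none = 0 := by
    by_contra h0
    refine ha (fun i => y (some i) / y none) ?_
    simp only [div_pow, mul_div_assoc']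
    rw [← Finset.sum_div, div_eq_iff (pow_ne_zero 2 h0)]
    linear_combination hy
  rw [h0] at hy
  have h1 := h (fun i => y (some i)) (by simpa using hy)
  funext o
  cases o with
  | none => exact h0
  | some i => exact congrFun h1 i

variable {F : Type u} [Field F] {ι : Type*} [Fintype ι]

theorem IsAnisotropicDiag.rational {c : ι → F} (h : IsAnisotropicDiag c) (n : ℕ) :
    IsAnisotropicDiag fun i => algebraMap F (FractionRing (MvPolynomial (Fin n) F)) (c i) := by
  simpa only [IsScalarTower.algebraMap_apply F (MvPolynomial (Fin n) F)
    (FractionRing (MvPolynomial (Fin n) F)), MvPolynomial.algebraMap_eq] using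
    (h.mvPolynomial n).fractionRing (FractionRing (MvPolynomial (Fin n) F))

/-- A constant represented over a rational function field is represented over the base field. -/
theorem IsAnisotropicDiag.exists_of_rational {c : ι → F} (h : IsAnisotropicDiag c) {n : ℕ} {a : F}
    {v : ι → FractionRing (MvPolynomial (Fin n) F)}
    (hv : ∑ i, algebraMap F _ (c i) * v i ^ 2 = algebraMap F _ a) :
    ∃ e : ι → F, ∑ i, c i * e i ^ 2 = a := by
  by_contra! hcon
  -- Otherwise `c ⊥ ⟨-a⟩` is anisotropic over the base and remains so over the rational function
  -- field, where `(1, v)` is a zero.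
  have h1 := (h.option hcon).rational n (fun o => o.elim 1 v) (by
    simp only [Fintype.sum_option, Option.elim_none, Option.elim_some, hv, map_neg]
    ring)
  exact one_ne_zero (congrFun h1 none)

/-- Splitting off a vector `e` of value `a ≠ 0` from a diagonal form: there is an orthogonal basis
`f` of the orthogonal complement of `e`, and `β` gives the coordinates with respect to it. -/
theorem exists_orthogonal_complement [Invertible (2 : F)] [DecidableEq ι] (c e : ι → F) {a : F}
    (ha : a ≠ 0) (he : ∑ i, c i * e i ^ 2 = a) :
    ∃ (m : ℕ) (c' : Fin m → F) (f β : Fin m → ι → F),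
      (∀ k l, ∑ i, c i * (f k i * f l i) = if k = l then c' k else 0) ∧
      (∀ k, ∑ i, c i * (e i * f k i) = 0) ∧ (∀ k, f k ≠ 0) ∧
      ∀ i j, (if j = i then 1 else 0) = c j * e j / a * e i + ∑ k, β k j * f k i := by
  let B : LinearMap.BilinForm F (ι → F) :=
    LinearMap.mk₂ F (fun x y => ∑ i, c i * (x i * y i))
      (fun x y z => by simp [add_mul, mul_add, Finset.sum_add_distrib])
      (fun r x y => by
        simp only [Pi.smul_apply, smul_eq_mul, Finset.mul_sum]
        exact Finset.sum_congr rfl fun i _ => by ring)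
      (fun x y z => by simp [mul_add, Finset.sum_add_distrib])
      (fun r x y => by
        simp only [Pi.smul_apply, smul_eq_mul, Finset.mul_sum]
        exact Finset.sum_congr rfl fun i _ => by ring)
  have hB : ∀ x y, B x y = ∑ i, c i * (x i * y i) := fun x y => rfl
  have hsymm : B.IsSymm := ⟨fun x y => by
    simp only [hB]
    exact Finset.sum_congr rfl fun i _ => by ring⟩
  have hBe : B e e = a := by
    rw [hB, ← he]
    exact Finset.sum_congr rfl fun i _ => by ring
  let U := LinearMap.ker (B e)
  obtain ⟨f, hf⟩ := LinearMap.BilinForm.exists_orthogonal_basis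
    (show (B.domRestrict₁₂ U U).IsSymm from ⟨fun x y => hsymm.eq x y⟩)
  have hU : ∀ y, y - (B e y / a) • e ∈ U := by
    intro y
    rw [LinearMap.mem_ker, map_sub, map_smul, hBe, smul_eq_mul, div_mul_cancel₀ _ ha, sub_self]
  -- `β k j` is the k-th coordinate of the projection of the j-th standard vector to `U`. The last
  -- clause splits that vector into its component along `e` and this projection.
  refine ⟨_, fun k => B (f k) (f k), fun k => f k,
    fun k j => f.repr ⟨_, hU (Pi.single j 1)⟩ k, fun k l => ?_, fun k => ?_, fun k => ?_,
    fun i j => ?_⟩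
  · split_ifs with hkl
    · rw [hkl]
      exact (hB _ _).symm
    · exact hf hkl
  · exact (f k).2
  · exact fun h0 => f.ne_zero k (Subtype.ext h0)
  · have h1 := congrArg (fun z : U => (z : ι → F) i) (f.sum_repr ⟨_, hU (Pi.single j 1)⟩)
    have h2 : B e (Pi.single j 1) = c j * e j := by
      rw [hB, Finset.sum_eq_single j (fun k _ hk => by simp [hk]) (by simp)]
      simp
    simp only [Submodule.coe_sum, Finset.sum_apply, Submodule.coe_smul, Pi.smul_apply, smul_eq_mul,
      Pi.sub_apply, h2, Pi.single_apply] at h1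
    simp only [h2] at h1 ⊢
    rw [h1]
    simp only [eq_comm (a := i)]
    ring

theorem coeff_quadratic_eq {R : Type*} [CommRing R] {a b c a' c' : R}
    (h : C a * X ^ 2 + C b * X + C c = C a' * X ^ 2 + C c') : a = a' ∧ b = 0 ∧ c = c' := by
  refine ⟨?_, ?_, ?_⟩
  · simpa [coeff_X, coeff_C] using congrArg (coeff · 2) h
  · simpa [coeff_X, coeff_C, coeff_X_pow] using congrArg (coeff · 1) h
  · simpa using congrArg (coeff · 0) h

theorem sum_mul_sum_mul_sum {R : Type*} [CommRing R] {ι κ : Type*} [Fintype ι] [Fintype κ]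
    [DecidableEq κ] {c : ι → R} {c' : κ → R} {f : κ → ι → R}
    (h : ∀ k l, ∑ i, c i * (f k i * f l i) = if k = l then c' k else 0) (x y : κ → R) :
    ∑ i, c i * ((∑ k, x k * f k i) * ∑ l, y l * f l i) = ∑ k, c' k * (x k * y k) := by
  calc ∑ i, c i * ((∑ k, x k * f k i) * ∑ l, y l * f l i)
      = ∑ l, ∑ k, x k * y l * ∑ i, c i * (f k i * f l i) := by
        simp only [Finset.sum_mul, Finset.mul_sum]
        rw [Finset.sum_comm]
        refine Finset.sum_congr rfl fun l _ => ?_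
        rw [Finset.sum_comm]
        exact Finset.sum_congr rfl fun k _ => Finset.sum_congr rfl fun i _ => by ring
    _ = ∑ k, c' k * (x k * y k) := by
        simp only [h, mul_ite, mul_zero, Finset.sum_ite_eq', Finset.mem_univ, if_true]
        exact Finset.sum_congr rfl fun k _ => by ring

/-- Reflection in `x - y`: if `x` and `y` have the same value, then every vector orthogonal to `x`
can be replaced by one of the same value orthogonal to `y`. -/
theorem IsAnisotropicDiag.exists_reflection {K : Type*} [Field K] {ι : Type*} [Fintype ι]
    {c : ι → K} (h : IsAnisotropicDiag c) {x y z : ι → K}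
    (hxy : ∑ i, c i * x i ^ 2 = ∑ i, c i * y i ^ 2) (hxz : ∑ i, c i * (x i * z i) = 0) :
    ∃ z' : ι → K, ∑ i, c i * z' i ^ 2 = ∑ i, c i * z i ^ 2 ∧ ∑ i, c i * (y i * z' i) = 0 := by
  by_cases hD : x = y
  · exact ⟨z, rfl, hD ▸ hxz⟩
  set D := ∑ i, c i * (x i - y i) ^ 2 with hDdef
  have hD0 : D ≠ 0 := fun h0 => hD (sub_eq_zero.mp (h (x - y) h0))
  set s := ∑ i, c i * (y i * z i) with hs
  set b := ∑ i, c i * (y i * (x i - y i)) with hb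
  have e1 : ∑ i, c i * (z i * (x i - y i)) = -s := by
    rw [← zero_sub, ← hxz, hs, ← Finset.sum_sub_distrib]
    exact Finset.sum_congr rfl fun i _ => by ring
  have e2 : 2 * b = -D := by
    have : D = (∑ i, c i * x i ^ 2) - (∑ i, c i * y i ^ 2) - 2 * b := by
      rw [hDdef, hb, Finset.mul_sum, ← Finset.sum_sub_distrib, ← Finset.sum_sub_distrib]
      exact Finset.sum_congr rfl fun i _ => by ring
    rw [this, hxy]
    ring
  have e3 : ∀ r : K, ∑ i, c i * (z i + r * (x i - y i)) ^ 2 = (∑ i, c i * z i ^ 2)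
      + 2 * r * (∑ i, c i * (z i * (x i - y i))) + r ^ 2 * D := by
    intro r
    rw [hDdef, Finset.mul_sum, Finset.mul_sum, ← Finset.sum_add_distrib,
      ← Finset.sum_add_distrib]
    exact Finset.sum_congr rfl fun i _ => by ring
  have e4 : ∀ r : K, ∑ i, c i * (y i * (z i + r * (x i - y i))) = s + r * b := by
    intro r
    rw [hs, hb, Finset.mul_sum, ← Finset.sum_add_distrib]
    exact Finset.sum_congr rfl fun i _ => by ring
  -- The reflection of `z` subtracts `2 B(z, x - y) / D` times `x - y`, and `B(z, x - y) = -s`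
  -- because `z` is orthogonal to `x`.
  refine ⟨fun i => z i + 2 * s / D * (x i - y i), ?_, ?_⟩
  · rw [e3, e1]
    field_simp
    ring
  · rw [e4]
    field_simp
    linear_combination s * e2

/-- An anisotropic diagonal form which represents the generic value of `∑ i, a i * X i ^ 2`
contains that form. -/
theorem IsAnisotropicDiag.exists_orthogonal_of_rational [Invertible (2 : F)] {n : ℕ} :
    ∀ {m : ℕ} {c : Fin m → F}, IsAnisotropicDiag c → ∀ {a : Fin n → F}, (∀ i, a i ≠ 0) →
    ∀ {w : Fin m → FractionRing (MvPolynomial (Fin n) F)},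
      ∑ j, algebraMap F _ (c j) * w j ^ 2 =
        ∑ i, algebraMap F _ (a i) * algebraMap (MvPolynomial (Fin n) F) _ (MvPolynomial.X i) ^ 2 →
    ∃ e : Fin n → Fin m → F, ∀ k l, ∑ j, c j * (e k j * e l j) = if k = l then a k else 0 := by
  induction n with
  | zero => exact fun _ _ _ _ _ => ⟨fun k => k.elim0, fun k => k.elim0⟩
  | succ n ih =>
    intro m c hc a ha w hw
    let R := MvPolynomial (Fin n) F
    let K := FractionRing R
    obtain ⟨g, hg⟩ := IsLocalization.exist_integer_multiples_of_finite
      (nonZeroDivisors (MvPolynomial (Fin (n + 1)) F)) w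
    choose z hz using hg
    have hz' : ∑ j, MvPolynomial.C (c j) * z j ^ 2 =
        (∑ i, MvPolynomial.C (a i) * MvPolynomial.X i ^ 2) * (g : MvPolynomial _ F) ^ 2 := by
      apply IsFractionRing.injective (MvPolynomial (Fin (n + 1)) F)
        (FractionRing (MvPolynomial (Fin (n + 1)) F))
      simp only [map_sum, map_mul, map_pow, hz, Algebra.smul_def, ← MvPolynomial.algebraMap_eq,
        ← IsScalarTower.algebraMap_apply]
      rw [← hw, Finset.sum_mul]
      exact Finset.sum_congr rfl fun i _ => by ring
    -- The variable with index 0 becomes the polynomial variable, and the other `n` variables move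
    -- into the coefficient field `K`.
    let θ : MvPolynomial (Fin (n + 1)) F →+* K[X] :=
      (Polynomial.mapRingHom (algebraMap R K)).comp
        (MvPolynomial.finSuccEquiv F n).toRingEquiv.toRingHom
    have hθ : Function.Injective θ :=
      (Polynomial.map_injective _ (IsFractionRing.injective R K)).comp
        (MvPolynomial.finSuccEquiv F n).injective
    have hθC : ∀ r : F, θ (MvPolynomial.C r) = C (algebraMap F K r) := fun r => by
      simp [θ, MvPolynomial.finSuccEquiv_apply, IsScalarTower.algebraMap_apply F R K,
        MvPolynomial.algebraMap_eq, R]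
    have hθ0 : θ (MvPolynomial.X 0) = X := by
      simp [θ, MvPolynomial.finSuccEquiv_X_zero]
    have hθs : ∀ i : Fin n, θ (MvPolynomial.X i.succ) = C (algebraMap R K (MvPolynomial.X i)) :=
      fun i => by simp [θ, R, MvPolynomial.finSuccEquiv_X_succ]
    set d : K := ∑ i : Fin n, algebraMap F K (a i.succ) *
      algebraMap R K (MvPolynomial.X i) ^ 2 with hd
    have hcK : IsAnisotropicDiag fun j => algebraMap F K (c j) := hc.rational n
    obtain ⟨u, hu⟩ := hcK.exists_polynomial (f := C (algebraMap F K (a 0)) * X ^ 2 + C d)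
      (g := θ g) (w := fun j => θ (z j))
      (by
        rw [← map_zero θ]
        exact hθ.ne (nonZeroDivisors.ne_zero g.2))
      (by
        have h1 := congrArg θ hz'
        simp only [Fin.sum_univ_succ (n := n), map_add, map_sum, map_mul, map_pow, hθC, hθ0,
          hθs] at h1
        rw [h1, hd]
        simp only [map_sum, map_mul, map_pow])
    -- The represented polynomial is quadratic in X, so anisotropy makes the representing vector
    -- linear in X.
    have hdeg := hcK.natDegree_le (u := u) (N := 1) (by
      rw [hu]
      compute_degree)
    set v₀ : Fin m → K := fun j => (u j).coeff 0 with hv₀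
    set v₁ : Fin m → K := fun j => (u j).coeff 1 with hv₁
    have huv : ∀ j, u j = C (v₁ j) * X + C (v₀ j) := fun j =>
      eq_X_add_C_of_natDegree_le_one (hdeg j)
    have hexp : C (∑ j, algebraMap F K (c j) * v₁ j ^ 2) * X ^ 2 +
        C (2 * ∑ j, algebraMap F K (c j) * (v₁ j * v₀ j)) * X +
        C (∑ j, algebraMap F K (c j) * v₀ j ^ 2) = C (algebraMap F K (a 0)) * X ^ 2 + C d := by
      rw [← hu]
      simp only [map_sum, map_mul, Finset.mul_sum, Finset.sum_mul, ← Finset.sum_add_distrib]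
      refine Finset.sum_congr rfl fun j _ => ?_
      rw [huv j]
      simp only [map_pow, map_ofNat]
      ring
    obtain ⟨h11, h10, h00⟩ := coeff_quadratic_eq hexp
    have h2 : (2 : K) ≠ 0 := by
      rw [← map_ofNat (algebraMap F K) 2]
      exact (_root_.map_ne_zero _).mpr (isUnit_of_invertible (2 : F)).ne_zero
    obtain ⟨e₀, he₀⟩ := hc.exists_of_rational h11
    -- Both `v₁` and the constant vector `e₀` have value `a 0`. The reflection exchanging them moves
    -- `v₀` to a vector `v` orthogonal to `e₀`, still of value `d`.
    obtain ⟨v, hv, hve⟩ := hcK.exists_reflection (x := v₁) (y := fun j => algebraMap F K (e₀ j))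
      (by
        rw [h11, ← he₀]
        simp only [map_sum, map_mul, map_pow])
      ((mul_eq_zero.mp h10).resolve_left h2)
    obtain ⟨m', c', f, β, hff, hef, hf0, hβ⟩ := exists_orthogonal_complement c e₀ (ha 0) he₀
    have hc' : IsAnisotropicDiag c' := by
      intro y hy
      have h0 : (fun i => ∑ k, y k * f k i) = 0 := by
        apply hc
        rw [← hy]
        simpa only [sq] using sum_mul_sum_mul_sum hff y y
      -- Pairing the zero vector with `f l` gives `c' l * y l = 0`, and `c' l` is the value at `f l
      -- ≠ 0`.
      funext l
      have h1 := sum_mul_sum_mul_sum hff y (Pi.single l 1)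
      simp only [show ∀ i, ∑ k, y k * f k i = 0 from congrFun h0, zero_mul, mul_zero,
        Finset.sum_const_zero] at h1
      rw [Finset.sum_eq_single l (fun k _ hk => by simp [hk]) (by simp), Pi.single_eq_same,
        mul_one] at h1
      refine (mul_eq_zero.mp h1.symm).resolve_left fun hl => hf0 l (hc _ ?_)
      have h3 := hff l l
      rw [if_pos rfl, hl] at h3
      simpa only [sq] using h3
    -- The coordinates of `v` with respect to `f`, extended to `K`: there is no component along
    -- `e₀`. So `c'` takes the value `d` at `α`, as the induction hypothesis requires.
    set α : Fin m' → K := fun k => ∑ j, algebraMap F K (β k j) * v j with hα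
    have hvα : ∀ i, v i = ∑ k, α k * algebraMap F K (f k i) := by
      intro i
      calc v i = ∑ j, algebraMap F K (if j = i then 1 else 0) * v j := by
            simp
        _ = ∑ j, algebraMap F K (c j * e₀ j / a 0 * e₀ i + ∑ k, β k j * f k i) * v j := by
            simp only [hβ]
        _ = algebraMap F K (e₀ i / a 0) *
              ∑ j, algebraMap F K (c j) * (algebraMap F K (e₀ j) * v j) +
            ∑ k, α k * algebraMap F K (f k i) := by
          simp only [hα, map_add, map_sum, map_mul, map_div₀, add_mul, Finset.sum_add_distrib,
            Finset.mul_sum, Finset.sum_mul]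
          congr 1
          · exact Finset.sum_congr rfl fun j _ => by ring
          · rw [Finset.sum_comm]
            exact Finset.sum_congr rfl fun k _ => Finset.sum_congr rfl fun j _ => by ring
        _ = ∑ k, α k * algebraMap F K (f k i) := by rw [hve, mul_zero, zero_add]
    have hffK : ∀ k l, ∑ i, algebraMap F K (c i) * (algebraMap F K (f k i) * algebraMap F K (f l i))
        = if k = l then algebraMap F K (c' k) else 0 := by
      intro k l
      have h3 := congrArg (algebraMap F K) (hff k l)
      simpa only [map_sum, map_mul, apply_ite (algebraMap F K), map_zero] using h3
    obtain ⟨e', he'⟩ := ih hc' (a := fun i => a i.succ) (fun i => ha _) (w := α) (by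
      rw [← hd, ← h00, ← hv]
      have h3 := sum_mul_sum_mul_sum hffK α α
      simp only [← hvα, ← sq] at h3
      exact h3.symm)
    have hef' : ∀ k, ∑ i, c i * (e₀ i * ∑ l, e' k l * f l i) = 0 := by
      intro k
      simp only [Finset.mul_sum]
      rw [Finset.sum_comm]
      refine Finset.sum_eq_zero fun l _ => ?_
      rw [← mul_zero (e' k l), ← hef l, Finset.mul_sum]
      exact Finset.sum_congr rfl fun i _ => by ring
    refine ⟨Fin.cons e₀ fun k i => ∑ l, e' k l * f l i, fun k l => ?_⟩
    refine Fin.cases ?_ (fun k => ?_) k <;> refine Fin.cases ?_ (fun l => ?_) l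
    · simp only [Fin.cons_zero, if_true]
      rw [← he₀]
      simp only [sq]
    · simp only [Fin.cons_zero, Fin.cons_succ, (Fin.succ_ne_zero l).symm, if_false]
      exact hef' l
    · simp only [Fin.cons_zero, Fin.cons_succ, Fin.succ_ne_zero, if_false]
      rw [← hef' k]
      exact Finset.sum_congr rfl fun i _ => by ring
    · simp only [Fin.cons_succ, Fin.succ_inj]
      rw [sum_mul_sum_mul_sum hff, he' k l]

end Subform

/-! ### Values over extensions as polynomial values; change of coordinates -/

section BaseChange

variable {K : Type*} [CommRing K] {V : Type*} [AddCommGroup V] [Module K V]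

theorem baseChange_sum_tmul [Invertible (2 : K)] {ι : Type*} [Fintype ι] (φ : QuadraticForm K V)
    (b : Module.Basis ι K V) (R : Type*) [CommRing R] [Algebra K R] (r : ι → R) :
    φ.baseChange R (∑ i, r i ⊗ₜ[K] b i) = MvPolynomial.aeval r (toPolynomial φ b) := by
  let inst : Invertible (2 : R) :=
    (Invertible.map (algebraMap K R) 2).copy 2 (map_ofNat _ _).symm
  rw [toPolynomial_eq, ← QuadraticMap.associated_eq_self_apply R (φ.baseChange R),
    QuadraticForm.associated_baseChange]
  simp only [map_sum, LinearMap.sum_apply, LinearMap.BilinForm.baseChange_tmul, map_mul,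
    MvPolynomial.aeval_X, MvPolynomial.aeval_C]
  rw [Finset.sum_comm]
  simp only [Algebra.smul_def]

theorem toPolynomial_of_isOrtho [Invertible (2 : K)] {ι : Type*} [Fintype ι]
    {φ : QuadraticForm K V}
    {b : Module.Basis ι K V} (hb : (QuadraticMap.associated (R := K) φ).IsOrthoᵢ b) :
    toPolynomial φ b = ∑ i, MvPolynomial.C (φ (b i)) * MvPolynomial.X i ^ 2 := by
  rw [toPolynomial_eq]
  refine Finset.sum_congr rfl fun i _ => ?_
  rw [Finset.sum_eq_single i (fun j _ hj => by
    rw [show QuadraticMap.associated φ (b i) (b j) = 0 from hb hj.symm, map_zero, zero_mul])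
    (by simp), QuadraticMap.associated_eq_self_apply, sq]

theorem baseChange_sum_tmul_of_isOrtho [Invertible (2 : K)] {ι : Type*} [Fintype ι]
    {φ : QuadraticForm K V}
    {b : Module.Basis ι K V} (hb : (QuadraticMap.associated (R := K) φ).IsOrthoᵢ b)
    (R : Type*) [CommRing R] [Algebra K R] (r : ι → R) :
    φ.baseChange R (∑ i, r i ⊗ₜ[K] b i) = ∑ i, algebraMap K R (φ (b i)) * r i ^ 2 := by
  rw [baseChange_sum_tmul, toPolynomial_of_isOrtho hb]
  simp

theorem exists_eq_sum_tmul {ι : Type*} [Fintype ι] (b : Module.Basis ι K V)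
    (R : Type*) [CommRing R] [Algebra K R] (x : R ⊗[K] V) :
    ∃ r : ι → R, x = ∑ i, r i ⊗ₜ[K] b i := by
  refine ⟨(b.baseChange R).repr x, ?_⟩
  conv_lhs => rw [← (b.baseChange R).sum_repr x]
  refine Finset.sum_congr rfl fun i _ => ?_
  rw [Module.Basis.baseChange_apply, TensorProduct.smul_tmul', smul_eq_mul, mul_one]

theorem map_sum_smul_of_isOrtho [Invertible (2 : K)] {ι : Type*} [Fintype ι]
    {φ : QuadraticForm K V}
    {b : Module.Basis ι K V} (hb : (QuadraticMap.associated (R := K) φ).IsOrthoᵢ b) (y : ι → K) :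
    φ (∑ i, y i • b i) = ∑ i, φ (b i) * y i ^ 2 := by
  rw [← eval_toPolynomial, toPolynomial_of_isOrtho hb]
  simp

theorem isAnisotropicDiag_of_isOrtho [Invertible (2 : K)] {ι : Type*} [Fintype ι]
    {φ : QuadraticForm K V}
    {b : Module.Basis ι K V} (hb : (QuadraticMap.associated (R := K) φ).IsOrthoᵢ b)
    (hφ : φ.Anisotropic) : IsAnisotropicDiag fun i => φ (b i) := by
  intro y hy
  rw [← map_sum_smul_of_isOrtho hb] at hy
  funext i
  exact Fintype.linearIndependent_iff.mp b.linearIndependent y (hφ _ hy) i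

theorem baseChange_map [Invertible (2 : K)] {W : Type*} [AddCommGroup W] [Module K W]
    {φ : QuadraticForm K V}
    {ψ : QuadraticForm K W} {f : V →ₗ[K] W} (hf : ∀ v, ψ (f v) = φ v)
    (R : Type*) [CommRing R] [Algebra K R] (x : R ⊗[K] V) :
    ψ.baseChange R (f.baseChange R x) = φ.baseChange R x := by
  have : (ψ.baseChange R).comp (f.baseChange R) = φ.baseChange R := by
    ext v
    simp [hf]
  exact congrArg (· x) this

/-- The linear substitution of variables which belongs to a change of basis. -/
def substHom {ι : Type*} [Fintype ι] (b b' : Module.Basis ι K V) :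
    MvPolynomial ι K →ₐ[K] MvPolynomial ι K :=
  MvPolynomial.aeval fun i => ∑ k, b.repr (b' k) i • MvPolynomial.X k

/-- The substitution turns the generic vector in the coordinates of `b` into the one in the
coordinates of `b'`. This allows passage from an arbitrary basis to an orthogonal one. -/
theorem substHom_toPolynomial [Invertible (2 : K)] {ι : Type*} [Fintype ι] (φ : QuadraticForm K V)
    (b b' : Module.Basis ι K V) : substHom b b' (toPolynomial φ b) = toPolynomial φ b' := by
  rw [substHom, ← baseChange_sum_tmul, toPolynomial]
  congr 1
  simp only [TensorProduct.sum_tmul]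
  rw [Finset.sum_comm]
  refine Finset.sum_congr rfl fun k _ => ?_
  simp only [TensorProduct.smul_tmul]
  rw [← TensorProduct.tmul_sum, b.sum_repr]

theorem substHom_injective {ι : Type*} [Fintype ι] (b b' : Module.Basis ι K V) :
    Function.Injective (substHom b b') := by
  classical
  have h : (substHom b' b).comp (substHom b b') = AlgHom.id K _ := by
    refine MvPolynomial.algHom_ext fun i => ?_
    simp only [substHom, AlgHom.comp_apply, MvPolynomial.aeval_X, map_sum, map_smul,
      AlgHom.id_apply, Finset.smul_sum, smul_smul]
    rw [Finset.sum_comm]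
    have e : ∀ l, ∑ k, b.repr (b' k) i * b'.repr (b l) k = if l = i then 1 else 0 := by
      intro l
      have h1 := congrArg (fun v => b.repr v i) (b'.sum_repr (b l))
      simp only [map_sum, map_smul, Finsupp.coe_finsetSum, Finset.sum_apply, Finsupp.smul_apply,
        smul_eq_mul, b.repr_self, Finsupp.single_apply] at h1
      rw [← h1]
      exact Finset.sum_congr rfl fun k _ => mul_comm _ _
    simp only [← Finset.sum_smul, e, ite_smul, one_smul, zero_smul, Finset.sum_ite_eq',
      Finset.mem_univ, if_true]
  intro x y hxy
  have := congrArg (substHom b' b) hxy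
  rwa [← AlgHom.comp_apply, ← AlgHom.comp_apply, h] at this

end BaseChange

/-! ### From isometric embeddings to subforms, and the subform theorem -/

section Field

variable {F : Type u} [Field F] {V : Type v} [AddCommGroup V] [Module F V]
  {W : Type w} [AddCommGroup W] [Module F W]

theorem nondegenerate_of_anisotropic [Invertible (2 : F)] {φ : QuadraticForm F V}
    (h : φ.Anisotropic) :
    φ.Nondegenerate := by
  rw [QuadraticMap.nondegenerate_iff_radical_eq_bot, eq_bot_iff]
  intro x hx
  exact h x (QuadraticMap.mem_radical_iff'.mp hx).1

/-- Anisotropy of `p` makes `f` injective. Anisotropy of `q` makes the image meet its orthogonal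
complement trivially, so the space is their orthogonal sum. The restriction of `q` to the complement
is anisotropic, hence non-degenerate, and serves as `r`. -/
theorem isSubform_of_isometry [Invertible (2 : F)] [FiniteDimensional F W] {p : QuadraticForm F V}
    {q : QuadraticForm F W} (hp : p.Anisotropic) (hq : q.Anisotropic) (f : V →ₗ[F] W)
    (hf : ∀ v, q (f v) = p v) : IsSubform p q := by
  have hinj : Function.Injective f := by
    rw [← LinearMap.ker_eq_bot, LinearMap.ker_eq_bot']
    intro v hv
    exact hp v (by rw [← hf, hv, map_zero])
  let B := QuadraticMap.associated (R := F) q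
  let U := LinearMap.range f
  let U' := LinearMap.BilinForm.orthogonal B U
  have hB : B.IsSymm := QuadraticForm.associated_isSymm F q
  have hc : IsCompl U U' := by
    rw [LinearMap.BilinForm.isCompl_orthogonal_iff_disjoint hB.isRefl, Submodule.disjoint_def]
    intro x hx hx'
    apply hq
    rw [← QuadraticMap.associated_eq_self_apply F q]
    exact hx' x hx
  let g := (Module.finBasis F U').equivFun
  let r : QuadraticForm F (Fin (Module.finrank F U') → F) :=
    q.comp (U'.subtype ∘ₗ g.symm.toLinearMap)
  have hr : r.Anisotropic := by
    intro y hy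
    have := hq _ hy
    simpa using this
  refine ⟨_, r, nondegenerate_of_anisotropic hr, QuadraticMap.Equivalent.symm ⟨?_⟩⟩
  let e : (V × (Fin (Module.finrank F U') → F)) ≃ₗ[F] W :=
    ((LinearEquiv.ofInjective f hinj).prodCongr g.symm).trans (Submodule.prodEquivOfIsCompl _ _ hc)
  refine { e with map_app' := ?_ }
  rintro ⟨x, y⟩
  have he : e (x, y) = f x + g.symm y := by simp [e]
  have ho : QuadraticMap.polar q (f x) (g.symm y) = 0 := by
    have h1 : B (f x) (g.symm y) = 0 := (g.symm y).2 _ (LinearMap.mem_range_self f x)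
    have h2 := congrArg (fun B' => B' (f x) (g.symm y : W)) (QuadraticMap.two_nsmul_associated F q)
    simp only [LinearMap.smul_apply, QuadraticMap.polarBilin_apply_apply] at h2
    rw [← h2]
    exact (congrArg _ h1).trans (smul_zero _)
  change q (e (x, y)) = _
  rw [he, QuadraticMap.map_add q, ho, add_zero, hf]
  simp [r]

theorem exists_isometry_of_isSubform {p : QuadraticForm F V} {q : QuadraticForm F W}
    (h : IsSubform p q) : ∃ f : V →ₗ[F] W, ∀ v, q (f v) = p v := by
  obtain ⟨m, r, -, ⟨e⟩⟩ := h
  refine ⟨e.symm.toLinearEquiv.toLinearMap ∘ₗ LinearMap.inl F V _, fun v => ?_⟩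
  simp

theorem toPolynomial_ne_zero [Invertible (2 : F)] {n : ℕ} (hn : 1 ≤ n)
    {p : QuadraticForm F V} (hp : p.Anisotropic) (b : Module.Basis (Fin n) F V) :
    toPolynomial p b ≠ 0 := by
  intro h
  have h1 := eval_toPolynomial p b (Pi.single ⟨0, hn⟩ 1)
  rw [h, map_zero] at h1
  have h2 := Fintype.linearIndependent_iff.mp b.linearIndependent _ (hp _ h1.symm) ⟨0, hn⟩
  simp at h2

/-- The subform theorem. -/
theorem isSubform_of_rational [Invertible (2 : F)] [FiniteDimensional F W] {p : QuadraticForm F V}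
    {q : QuadraticForm F W} (hp : p.Anisotropic) (hq : q.Anisotropic) {n : ℕ}
    (b : Module.Basis (Fin n) F V)
    (h : ∃ y, q.baseChange (FractionRing (MvPolynomial (Fin n) F)) y =
      algebraMap (MvPolynomial (Fin n) F) _ (toPolynomial p b)) : IsSubform p q := by
  obtain ⟨y, hy⟩ := h
  have : FiniteDimensional F V := b.finiteDimensional_of_finite
  obtain ⟨bq, hbq⟩ := LinearMap.BilinForm.exists_orthogonal_basis
    (QuadraticForm.associated_isSymm F q)
  obtain ⟨bp, hbp⟩ := LinearMap.BilinForm.exists_orthogonal_basis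
    (QuadraticForm.associated_isSymm F p)
  have hn : n = Module.finrank F V := by simpa using (Module.finrank_eq_card_basis b).symm
  subst hn
  let R := MvPolynomial (Fin (Module.finrank F V)) F
  let K := FractionRing R
  have hinj : Function.Injective ((Algebra.ofId R K).restrictScalars F |>.comp (substHom b bp)) :=
    (IsFractionRing.injective R K).comp (substHom_injective b bp)
  -- The linear change of variables from `b` to the orthogonal basis `bp`, extended to rational
  -- functions. It fixes F, so it turns a representation of the generic value in one basis into a
  -- representation in the other.
  let σ : K →ₐ[F] K := IsFractionRing.liftAlgHom hinj
  obtain ⟨r, rfl⟩ := exists_eq_sum_tmul bq K y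
  rw [baseChange_sum_tmul_of_isOrtho hbq] at hy
  have hσ : σ (algebraMap R K (toPolynomial p b)) = algebraMap R K (toPolynomial p bp) := by
    rw [← substHom_toPolynomial p b bp]
    exact IsFractionRing.lift_algebraMap hinj _
  obtain ⟨e, he⟩ := (isAnisotropicDiag_of_isOrtho hbq hq).exists_orthogonal_of_rational
    (a := fun i => p (bp i)) (fun i h0 => bp.ne_zero i (hp _ h0)) (w := fun j => σ (r j)) (by
      have h1 := congrArg σ hy
      rw [hσ, toPolynomial_of_isOrtho hbp] at h1
      simp only [map_sum, map_mul, map_pow] at h1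
      exact (Finset.sum_congr rfl fun j _ => congrArg (· * σ (r j) ^ 2) (σ.commutes _).symm).trans
        h1)
  refine isSubform_of_isometry hp hq (bp.constr F fun k => ∑ j, e k j • bq j) fun v => ?_
  rw [bp.constr_apply_fintype F]
  conv_rhs => rw [← bp.sum_repr v, map_sum_smul_of_isOrtho hbp]
  have h2 : ∑ k, bp.equivFun v k • ∑ j, e k j • bq j
      = ∑ j, (∑ k, bp.repr v k * e k j) • bq j := by
    simp only [Finset.smul_sum, Finset.sum_smul, smul_smul, Module.Basis.equivFun_apply]
    rw [Finset.sum_comm]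
  rw [h2, map_sum_smul_of_isOrtho hbq]
  simpa only [← sq] using sum_mul_sum_mul_sum he (bp.repr v) (bp.repr v)

end Field

/-! ### The substitution x ↦ P t² on Laurent series -/

section Laurent

variable {F : Type*} [Field F] {K : Type*} [Field K]

/-- The substitution `x ↦ P x`, combined with a map of coefficients. -/
def laurentScale (f : F →+* K) (P : K) (hP : P ≠ 0) : F⸨X⸩ →+* K⸨X⸩ where
  toFun x := ⟨fun k => P ^ k * f (x.coeff k), x.isPWO_support.mono fun k hk h0 => hk (by
    simp only [h0, map_zero, mul_zero])⟩
  map_one' := by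
    ext k
    by_cases hk : k = 0 <;> simp [HahnSeries.coeff_one, hk]
  map_zero' := by
    ext k
    simp
  map_add' x y := by
    ext k
    simp [mul_add]
  map_mul' x y := by
    ext k
    simp only [HahnSeries.coeff_mul, map_sum, map_mul, Finset.mul_sum]
    -- Multiplication by powers of `P ≠ 0` and the injective map `f` preserve supports, so both sums
    -- run over the same pairs.
    refine Finset.sum_congr ?_ fun ij hij => ?_
    · ext ij
      simp [Finset.mem_antidiagonal, HahnSeries.mem_support, zpow_ne_zero _ hP]
    · have h := (Finset.mem_antidiagonal.mp hij).2.2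
      rw [← h, zpow_add₀ hP]
      ring

/-- The homomorphism `F((x)) → K((t))`, `x ↦ P t ^ 2`, which extends `f : F → K`. -/
def laurentSubst (f : F →+* K) (P : K) (hP : P ≠ 0) : F⸨X⸩ →+* K⸨X⸩ :=
  (HahnSeries.embDomainRingHom (AddMonoidHom.mulLeft (2 : ℤ))
    (fun a b h => by simpa using h) (fun a b => by simp)).comp (laurentScale f P hP)

variable {f : F →+* K} {P : K} {hP : P ≠ 0}

theorem coeff_laurentSubst_two_mul (x : F⸨X⸩) (k : ℤ) :
    (laurentSubst f P hP x).coeff (2 * k) = P ^ k * f (x.coeff k) :=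
  HahnSeries.embDomain_coeff (f := ⟨⟨AddMonoidHom.mulLeft (2 : ℤ), _⟩, _⟩)

theorem coeff_laurentSubst_of_odd (x : F⸨X⸩) {k : ℤ} (hk : Odd k) :
    (laurentSubst f P hP x).coeff k = 0 := by
  refine HahnSeries.embDomain_of_notMem_range fun ⟨l, hl⟩ => ?_
  have hl' : 2 * l = k := hl
  rw [← hl'] at hk
  exact (Int.not_odd_iff_even.mpr (even_two_mul l)) hk

theorem laurentSubst_single (k : ℤ) (r : F) :
    laurentSubst f P hP (HahnSeries.single k r) = HahnSeries.single (2 * k) (P ^ k * f r) := by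
  ext l
  rcases Int.even_or_odd l with hl | hl
  · obtain ⟨m, rfl⟩ := hl.two_dvd
    rw [coeff_laurentSubst_two_mul]
    by_cases hm : m = k
    · simp [hm]
    · rw [HahnSeries.coeff_single_of_ne hm, HahnSeries.coeff_single_of_ne (by omega), map_zero,
        mul_zero]
  · rw [coeff_laurentSubst_of_odd _ hl, HahnSeries.coeff_single_of_ne]
    rintro rfl
    exact (Int.not_odd_iff_even.mpr (even_two_mul k)) hl

theorem laurentSubst_algebraMap (r : F) :
    laurentSubst f P hP (algebraMap F F⸨X⸩ r) = HahnSeries.C (f r) := by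
  have h : algebraMap F F⸨X⸩ r = HahnSeries.C r := HahnSeries.ofPowerSeries_C r
  have := laurentSubst_single (f := f) (P := P) (hP := hP) 0 r
  rw [mul_zero, zpow_zero, one_mul] at this
  rw [h]
  exact this

theorem laurentSubst_laurentVar :
    laurentSubst f P hP (laurentVar F) = HahnSeries.single 2 P := by
  have := laurentSubst_single (f := f) (P := P) (hP := hP) 1 1
  simpa [laurentVar] using this

/-- If a diagonal form over `K` does not represent `P`, then `c ⊥ ⟨-P t ^ 2⟩` is anisotropic over
`K((t))`. -/
theorem IsAnisotropicDiag.sum_laurent {ι : Type*} [Fintype ι] {c : ι → K}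
    (h : IsAnisotropicDiag c) (ha : ∀ y : ι → K, ∑ i, c i * y i ^ 2 ≠ P) :
    IsAnisotropicDiag (Sum.elim (fun i => HahnSeries.C (c i)) fun _ : Unit =>
      (-HahnSeries.single 2 P : K⸨X⸩)) := by
  intro y hy
  simp only [Fintype.sum_sum_type, Sum.elim_inl, Sum.elim_inr, Finset.univ_unique,
    Finset.sum_singleton] at hy
  have hs : (HahnSeries.single 2 P : K⸨X⸩) = HahnSeries.C P * HahnSeries.single 1 1 ^ 2 := by
    rw [sq, HahnSeries.single_mul_single, HahnSeries.C_apply, HahnSeries.single_mul_single]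
    simp
  -- Multiplying the last coordinate by t absorbs the square t² and leaves the form `c ⊥ ⟨-P⟩` with
  -- constant coefficients.
  have h0 := (h.option ha).laurentSeries
    (fun o => o.elim (HahnSeries.single 1 1 * y (Sum.inr ())) fun i => y (Sum.inl i)) (by
      simp only [Fintype.sum_option, Option.elim_none, Option.elim_some, map_neg]
      rw [← hy, hs]
      simp only [PUnit.default_eq_unit]
      ring)
  funext o
  cases o with
  | inl i => exact congrFun h0 (some i)
  | inr i =>
    have h1 := congrFun h0 none
    simp only [Option.elim_none, Pi.zero_apply] at h1
    exact (mul_eq_zero.mp h1).resolve_left (HahnSeries.single_ne_zero one_ne_zero)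

end Laurent

/-! ### The forms p ⊥ ⟨a⟩ in coordinates -/

section Perp

variable {F : Type u} [Field F] {V : Type v} [AddCommGroup V] [Module F V]

section

variable {ι : Type t} (b : Module.Basis ι F V) (K : Type w) [Field K] [Algebra F K]

theorem perpBasis_inl (i : ι) : perpBasis b K (Sum.inl i) = (1 ⊗ₜ b i, 0) := by
  simp [perpBasis]

theorem perpBasis_inr : perpBasis b K (Sum.inr ()) = (0, 1) := by
  simp [perpBasis]

/-- The linear map between the spaces of `p_K ⊥ ⟨a⟩` and `q_K ⊥ ⟨a⟩` induced by a linear map between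
the spaces of `p` and `q`. -/
def perpMap {W : Type*} [AddCommGroup W] [Module F W] (f : V →ₗ[F] W) :
    (K ⊗[F] V) × K →ₗ[K] (K ⊗[F] W) × K :=
  (f.baseChange K).prodMap LinearMap.id

/-- The map is the identity on the one-dimensional summand, so the last coordinate survives. This
keeps the image of the generic zero non-trivial. -/
theorem perpMap_baseChange_eq_zero [Fintype ι] {W : Type*} [AddCommGroup W] [Module F W]
    {f : V →ₗ[F] W} {L : Type*} [CommRing L] [Algebra K L] {r : ι ⊕ Unit → L}
    (h : (perpMap K f).baseChange L (∑ o, r o ⊗ₜ[K] perpBasis b K o) = 0) :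
    r (Sum.inr ()) = 0 := by
  have h1 := congrArg (fun z => TensorProduct.rid K L ((LinearMap.snd K _ _).lTensor L z)) h
  simpa [perpMap, perpBasis_inl, perpBasis_inr] using h1

end

variable [Invertible (2 : F)] {ι : Type t} (p : QuadraticForm F V) (b : Module.Basis ι F V)

theorem associated_oneDim {K : Type*} [CommRing K] [Invertible (2 : K)] (a x y : K) :
    QuadraticMap.associated (R := K) (oneDim a) x y = a * (x * y) := by
  simp [oneDim]

theorem associated_baseChange_one_tmul (K : Type*) [CommRing K] [Algebra F K]
    [Invertible (2 : K)] (x y : V) :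
    QuadraticMap.associated (R := K) (p.baseChange K) (1 ⊗ₜ x) (1 ⊗ₜ y) =
      algebraMap F K (QuadraticMap.associated p x y) := by
  rw [QuadraticForm.associated_baseChange, LinearMap.BilinForm.baseChange_tmul, mul_one,
    Algebra.algebraMap_eq_smul_one]

variable (K : Type w) [Field K] [Algebra F K] (a : K)

theorem associated_perpOneDim [Invertible (2 : K)] (x y : (K ⊗[F] V) × K) :
    QuadraticMap.associated (R := K) (perpOneDim p K a) x y =
      QuadraticMap.associated (R := K) (p.baseChange K) x.1 y.1 + a * (x.2 * y.2) := by
  rw [perpOneDim, QuadraticMap.associated_prod, ← associated_oneDim]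
  rfl

theorem perpOneDim_perpBasis_inl (i : ι) :
    perpOneDim p K a (perpBasis b K (Sum.inl i)) = algebraMap F K (p (b i)) := by
  simp [perpBasis_inl, perpOneDim, Algebra.algebraMap_eq_smul_one]

theorem perpOneDim_perpBasis_inr : perpOneDim p K a (perpBasis b K (Sum.inr ())) = a := by
  simp [perpBasis_inr, perpOneDim, oneDim]

variable {p b}

theorem isOrtho_perpBasis [Invertible (2 : K)]
    (hb : (QuadraticMap.associated (R := F) p).IsOrthoᵢ b) :
    (QuadraticMap.associated (R := K) (perpOneDim p K a)).IsOrthoᵢ (perpBasis b K) := by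
  intro i j hij
  change QuadraticMap.associated (R := K) (perpOneDim p K a) _ _ = 0
  rw [associated_perpOneDim]
  rcases i with i | i <;> rcases j with j | j
  · rw [perpBasis_inl, perpBasis_inl, associated_baseChange_one_tmul,
      show QuadraticMap.associated p (b i) (b j) = 0 from hb fun h => hij (by rw [h])]
    simp
  · simp only [perpBasis_inl, perpBasis_inr b K, map_zero, zero_mul, mul_zero, add_zero]
  · simp only [perpBasis_inl, perpBasis_inr b K, map_zero, LinearMap.zero_apply, mul_zero,
      add_zero]
  · exact absurd rfl hij

variable (p b)

theorem toPolynomial_perpOneDim [Invertible (2 : K)] [Fintype ι] :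
    toPolynomial (perpOneDim p K a) (perpBasis b K) =
      MvPolynomial.rename Sum.inl (MvPolynomial.map (algebraMap F K) (toPolynomial p b)) +
        MvPolynomial.C a * MvPolynomial.X (Sum.inr ()) ^ 2 := by
  simp only [toPolynomial_eq, associated_perpOneDim, Fintype.sum_sum_type, perpBasis_inl,
    perpBasis_inr, associated_baseChange_one_tmul, map_sum, map_mul, MvPolynomial.map_C,
    MvPolynomial.map_X, MvPolynomial.rename_C, MvPolynomial.rename_X, Finset.univ_unique,
    PUnit.default_eq_unit, Finset.sum_singleton]
  simp [sq]

theorem perpOneDim_perpMap {W : Type*} [AddCommGroup W] [Module F W] {q : QuadraticForm F W}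
    {f : V →ₗ[F] W} (hf : ∀ v, q (f v) = p v) (x : (K ⊗[F] V) × K) :
    perpOneDim q K a (perpMap K f x) = perpOneDim p K a x := by
  simp [perpMap, perpOneDim, baseChange_map hf]

end Perp

/-! ### Embedding the coordinate ring of p ⊥ ⟨-x⟩ into F(X)((t)) -/

section FunctionField

/-- The generic point of the affine quadric `φ(X) = 0`. -/
theorem exists_generic_zero {K : Type*} [CommRing K] [Invertible (2 : K)] {V : Type*}
    [AddCommGroup V] [Module K V] {ι : Type*} [Fintype ι] (φ : QuadraticForm K V)
    (b : Module.Basis ι K V) :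
    ∃ r : ι → FunctionField φ b, φ.baseChange (FunctionField φ b) (∑ i, r i ⊗ₜ[K] b i) = 0 ∧
      ∀ i, r i = 0 → MvPolynomial.X i ∈ Ideal.span {toPolynomial φ b} := by
  let A := MvPolynomial ι K ⧸ Ideal.span {toPolynomial φ b}
  refine ⟨fun i => algebraMap A (FractionRing A) (Ideal.Quotient.mk _ (MvPolynomial.X i)), ?_,
    fun i hi => ?_⟩
  · rw [baseChange_sum_tmul]
    have h1 : MvPolynomial.aeval (fun i => algebraMap A (FractionRing A)
        (Ideal.Quotient.mk _ (MvPolynomial.X i))) =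
        (IsScalarTower.toAlgHom K A (FractionRing A)).comp
          (Ideal.Quotient.mkₐ K (Ideal.span {toPolynomial φ b})) :=
      MvPolynomial.algHom_ext fun o => by
        rw [MvPolynomial.aeval_X]
        rfl
    rw [h1, AlgHom.comp_apply, Ideal.Quotient.mkₐ_eq_mk, Ideal.Quotient.eq_zero_iff_mem.mpr
      (Ideal.mem_span_singleton_self _), map_zero]
  · rw [← Ideal.Quotient.eq_zero_iff_mem]
    exact IsFractionRing.injective A (FractionRing A) (hi.trans (map_zero _).symm)

variable {F : Type u} [Field F] {n : ℕ}

/-- The evaluation `X i ↦ X i`, `x ↦ P t ^ 2` of polynomials over `F((x))` in `F(X)((t))`. -/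
def laurentEval {P : FractionRing (MvPolynomial (Fin n) F)} (hP : P ≠ 0) :
    MvPolynomial (Fin n) F⸨X⸩ →+* (FractionRing (MvPolynomial (Fin n) F))⸨X⸩ :=
  MvPolynomial.eval₂Hom (laurentSubst (algebraMap F _) P hP) fun i =>
    HahnSeries.C (algebraMap (MvPolynomial (Fin n) F) _ (MvPolynomial.X i))

variable {P : FractionRing (MvPolynomial (Fin n) F)} (hP : P ≠ 0)

theorem laurentEval_apply (g : MvPolynomial (Fin n) F⸨X⸩) :
    laurentEval hP g = ∑ d ∈ g.support, laurentSubst (algebraMap F _) P hP (g.coeff d) *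
      HahnSeries.C (algebraMap (MvPolynomial (Fin n) F) _ (MvPolynomial.monomial d 1)) := by
  rw [laurentEval, MvPolynomial.coe_eval₂Hom, MvPolynomial.eval₂_eq']
  refine Finset.sum_congr rfl fun d _ => ?_
  rw [MvPolynomial.monomial_eq, MvPolynomial.C_1, one_mul, Finsupp.prod_fintype _ _ (by simp)]
  simp only [map_prod, map_pow]

theorem coeff_laurentEval_of_odd (g : MvPolynomial (Fin n) F⸨X⸩) {k : ℤ} (hk : Odd k) :
    (laurentEval hP g).coeff k = 0 := by
  rw [laurentEval_apply, HahnSeries.coeff_sum]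
  refine Finset.sum_eq_zero fun d _ => ?_
  rw [HahnSeries.C_apply, HahnSeries.coeff_mul_single_zero, coeff_laurentSubst_of_odd _ hk,
    zero_mul]

/-- The coefficient of t^(2k) is P^k times the polynomial over F formed by the x^k-coefficients of
`g`, and P is non-zero. -/
theorem eq_zero_of_coeff_laurentEval {g : MvPolynomial (Fin n) F⸨X⸩}
    (h : ∀ k : ℤ, (laurentEval hP g).coeff (2 * k) = 0) : g = 0 := by
  ext m k
  have h1 := h k
  have e : (laurentEval hP g).coeff (2 * k) = P ^ k * algebraMap (MvPolynomial (Fin n) F) _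
      (∑ d ∈ g.support, MvPolynomial.monomial d ((g.coeff d).coeff k)) := by
    rw [laurentEval_apply, HahnSeries.coeff_sum, map_sum, Finset.mul_sum]
    refine Finset.sum_congr rfl fun d _ => ?_
    rw [HahnSeries.C_apply, HahnSeries.coeff_mul_single_zero, coeff_laurentSubst_two_mul,
      mul_assoc, IsScalarTower.algebraMap_apply F (MvPolynomial (Fin n) F), ← map_mul,
      MvPolynomial.algebraMap_eq, MvPolynomial.C_mul_monomial, mul_one]
  rw [e] at h1
  have h2 := (mul_eq_zero.mp h1).resolve_left (zpow_ne_zero _ hP)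
  rw [map_eq_zero_iff _ (IsFractionRing.injective _ _)] at h2
  have h3 := congrArg (MvPolynomial.coeff m) h2
  simp only [MvPolynomial.coeff_sum, MvPolynomial.coeff_monomial, Finset.sum_ite_eq',
    MvPolynomial.coeff_zero] at h3
  by_cases hm : m ∈ g.support
  · simpa [hm] using h3
  · simp [MvPolynomial.notMem_support_iff.mp hm]

/-- The extension of `laurentEval` by `X (n + 1) ↦ t⁻¹`. -/
def quadricEval :
    MvPolynomial (Fin n ⊕ Unit) F⸨X⸩ →+* (FractionRing (MvPolynomial (Fin n) F))⸨X⸩ :=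
  MvPolynomial.eval₂Hom (laurentSubst (algebraMap F _) P hP) <| Sum.elim
    (fun i => HahnSeries.C (algebraMap (MvPolynomial (Fin n) F) _ (MvPolynomial.X i)))
    fun _ => HahnSeries.single (-1) 1

theorem quadricEval_X_inr (i : Unit) :
    quadricEval hP (MvPolynomial.X (Sum.inr i)) = HahnSeries.single (-1) 1 := by
  simp [quadricEval]

theorem quadricEval_rename (g : MvPolynomial (Fin n) F⸨X⸩) :
    quadricEval hP (MvPolynomial.rename Sum.inl g) = laurentEval hP g := by
  simp only [quadricEval, laurentEval, MvPolynomial.coe_eval₂Hom, MvPolynomial.eval₂_rename]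
  rfl

theorem laurentEval_map (g : MvPolynomial (Fin n) F) :
    laurentEval hP (MvPolynomial.map (algebraMap F F⸨X⸩) g) =
      HahnSeries.C (algebraMap (MvPolynomial (Fin n) F) _ g) := by
  have h : (laurentEval hP).comp (MvPolynomial.map (algebraMap F F⸨X⸩)) =
      HahnSeries.C.comp (algebraMap (MvPolynomial (Fin n) F) _) := by
    refine MvPolynomial.ringHom_ext (fun r => ?_) fun i => ?_
    · simp only [RingHom.comp_apply, laurentEval, MvPolynomial.map_C, MvPolynomial.coe_eval₂Hom,
        MvPolynomial.eval₂_C, laurentSubst_algebraMap]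
      rw [← MvPolynomial.algebraMap_eq, ← IsScalarTower.algebraMap_apply]
    · simp [laurentEval]
  exact congrArg (· g) h

theorem laurentVar_ne_zero : laurentVar F ≠ 0 := HahnSeries.single_ne_zero one_ne_zero

variable [Invertible (2 : F)] {V : Type v} [AddCommGroup V] [Module F V]
  (p : QuadraticForm F V) (b : Module.Basis (Fin n) F V)

/-- The polynomial `p(X) - x X (n + 1) ^ 2`. -/
abbrev quadricPolynomial : MvPolynomial (Fin n ⊕ Unit) F⸨X⸩ :=
  toPolynomial (perpOneDim p F⸨X⸩ (-laurentVar F)) (perpBasis b F⸨X⸩)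

/-- The coordinate ring of the affine cone over `p ⊥ ⟨-x⟩`. -/
abbrev QuadricRing : Type u :=
  MvPolynomial (Fin n ⊕ Unit) F⸨X⸩ ⧸ Ideal.span {quadricPolynomial p b}

/-- The function field of `p ⊥ ⟨-x⟩` over `F((x))`. -/
abbrev QuadricField : Type u :=
  FunctionField (perpOneDim p F⸨X⸩ (-laurentVar F)) (perpBasis b F⸨X⸩)

variable {p b}

theorem exists_sub_mem_span_quadricPolynomial (g : MvPolynomial (Fin n ⊕ Unit) F⸨X⸩) :
    ∃ a₀ a₁ : MvPolynomial (Fin n) F⸨X⸩,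
      g - (MvPolynomial.rename Sum.inl a₀ +
        MvPolynomial.rename Sum.inl a₁ * MvPolynomial.X (Sum.inr ())) ∈
        Ideal.span {quadricPolynomial p b} := by
  induction g using MvPolynomial.induction_on with
  | C r => exact ⟨MvPolynomial.C r, 0, by simp⟩
  | add g h hg hh =>
    obtain ⟨a₀, a₁, ha⟩ := hg
    obtain ⟨b₀, b₁, hb⟩ := hh
    refine ⟨a₀ + b₀, a₁ + b₁, ?_⟩
    have := Ideal.add_mem _ ha hb
    rw [map_add, map_add]
    convert this using 1
    ring
  | mul_X g i hg =>
    obtain ⟨a₀, a₁, ha⟩ := hg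
    rcases i with i | i
    · refine ⟨a₀ * MvPolynomial.X i, a₁ * MvPolynomial.X i, ?_⟩
      have := Ideal.mul_mem_right (MvPolynomial.X (Sum.inl i)) _ ha
      rw [map_mul, map_mul, MvPolynomial.rename_X]
      convert this using 1
      ring
    -- As x is a unit, the square of the last variable is congruent to x⁻¹ p(X), so the roles of
    -- `a₀` and `a₁` are exchanged.
    · refine ⟨a₁ * (MvPolynomial.C (laurentVar F)⁻¹ *
        MvPolynomial.map (algebraMap F F⸨X⸩) (toPolynomial p b)), a₀, ?_⟩
      have h1 := Ideal.mul_mem_right (MvPolynomial.X (Sum.inr ())) _ ha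
      have h2 := Ideal.mul_mem_left _ (-(MvPolynomial.rename Sum.inl a₁ *
        MvPolynomial.C (laurentVar F)⁻¹)) (Ideal.mem_span_singleton_self (quadricPolynomial p b))
      have h3 : (MvPolynomial.C (laurentVar F)⁻¹ * MvPolynomial.C (laurentVar F) :
          MvPolynomial (Fin n ⊕ Unit) F⸨X⸩) = 1 := by
        rw [← MvPolynomial.C_mul, inv_mul_cancel₀ laurentVar_ne_zero, MvPolynomial.C_1]
      have := Ideal.add_mem _ h1 h2
      rw [quadricPolynomial, toPolynomial_perpOneDim] at this
      simp only [map_mul, MvPolynomial.rename_C, map_neg] at this ⊢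
      rw [quadricPolynomial, toPolynomial_perpOneDim]
      simp only [map_neg]
      convert this using 1
      linear_combination (-(MvPolynomial.rename Sum.inl a₁ *
        MvPolynomial.X (Sum.inr ()) ^ 2)) * h3

variable (hP : algebraMap (MvPolynomial (Fin n) F) (FractionRing (MvPolynomial (Fin n) F))
  (toPolynomial p b) ≠ 0)

theorem quadricEval_quadricPolynomial : quadricEval hP (quadricPolynomial p b) = 0 := by
  rw [quadricPolynomial, toPolynomial_perpOneDim, map_add, quadricEval_rename, laurentEval_map,
    map_mul, map_pow, quadricEval_X_inr]
  have h : quadricEval hP (MvPolynomial.C (-laurentVar F)) = HahnSeries.single 2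
      (-algebraMap (MvPolynomial (Fin n) F) _ (toPolynomial p b)) := by
    simp [quadricEval, laurentSubst_laurentVar]
  rw [h, sq, HahnSeries.single_mul_single, HahnSeries.single_mul_single, HahnSeries.C_apply]
  simp

/-- A parity argument: modulo the quadric, `g` is `a₀ + a₁ X_{n+1}`. The image of `a₀` has only even
powers of t, while that of `a₁ X_{n+1}`, shifted by t⁻¹, has only odd ones. They cannot cancel, so
both vanish. -/
theorem quadricEval_eq_zero_iff {g : MvPolynomial (Fin n ⊕ Unit) F⸨X⸩} :
    quadricEval hP g = 0 ↔ g ∈ Ideal.span {quadricPolynomial p b} := by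
  have hI : ∀ g ∈ Ideal.span {quadricPolynomial p b}, quadricEval hP g = 0 := by
    intro g hg
    obtain ⟨r, rfl⟩ := Ideal.mem_span_singleton.mp hg
    rw [map_mul, quadricEval_quadricPolynomial, zero_mul]
  refine ⟨fun h => ?_, hI g⟩
  obtain ⟨a₀, a₁, ha⟩ := exists_sub_mem_span_quadricPolynomial (p := p) (b := b) g
  have h1 := hI _ ha
  rw [map_sub, h, zero_sub, neg_eq_zero, map_add, map_mul, quadricEval_rename, quadricEval_rename,
    quadricEval_X_inr] at h1
  have h2 : ∀ k, (laurentEval hP a₀).coeff k + (laurentEval hP a₁).coeff (k + 1) = 0 := by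
    intro k
    have := congrArg (fun s => HahnSeries.coeff s k) h1
    simpa [HahnSeries.coeff_mul_single] using this
  have h3 : a₀ = 0 := eq_zero_of_coeff_laurentEval hP fun k => by
    have := h2 (2 * k)
    rwa [coeff_laurentEval_of_odd hP a₁ (by simp), add_zero] at this
  have h4 : a₁ = 0 := eq_zero_of_coeff_laurentEval hP fun k => by
    have := h2 (2 * k - 1)
    rwa [coeff_laurentEval_of_odd hP a₀ (by simp), zero_add, sub_add_cancel] at this
  simpa [h3, h4] using ha

/-- The embedding of the coordinate ring of `p ⊥ ⟨-x⟩` over `F((x))` into `F(X)((t))`. -/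
def quadricEmbedding : QuadricRing p b →+* (FractionRing (MvPolynomial (Fin n) F))⸨X⸩ :=
  Ideal.Quotient.lift _ (quadricEval hP) fun _ hg => (quadricEval_eq_zero_iff hP).mpr hg

theorem quadricEmbedding_injective : Function.Injective (quadricEmbedding hP) := by
  rw [injective_iff_map_eq_zero]
  intro x hx
  obtain ⟨g, rfl⟩ := Ideal.Quotient.mk_surjective x
  rw [quadricEmbedding, Ideal.Quotient.lift_mk, quadricEval_eq_zero_iff] at hx
  exact Ideal.Quotient.eq_zero_iff_mem.mpr hx

variable {W : Type w} [AddCommGroup W] [Module F W] {q : QuadraticForm F W}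

/-- The image of the generic zero of `p ⊥ ⟨-x⟩` is a zero. It is non-trivial because its last
coordinate corresponds to t⁻¹ ≠ 0 under `quadricEval`. -/
theorem isIsotropic_of_isometry
    (hP : algebraMap (MvPolynomial (Fin n) F) (FractionRing (MvPolynomial (Fin n) F))
      (toPolynomial p b) ≠ 0)
    {f : V →ₗ[F] W} (hf : ∀ v, q (f v) = p v) :
    IsIsotropic ((perpOneDim q F⸨X⸩ (-laurentVar F)).baseChange
      (QuadricField p b)) := by
  obtain ⟨r, hr, hr0⟩ := exists_generic_zero (perpOneDim p F⸨X⸩ (-laurentVar F)) (perpBasis b F⸨X⸩)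
  refine ⟨(perpMap F⸨X⸩ f).baseChange (QuadricField p b) (∑ o, r o ⊗ₜ[F⸨X⸩] perpBasis b F⸨X⸩ o),
    fun h0 => ?_, ?_⟩
  · have h1 := (quadricEval_eq_zero_iff hP).mpr (hr0 _ (perpMap_baseChange_eq_zero b F⸨X⸩ h0))
    rw [quadricEval_X_inr] at h1
    exact HahnSeries.single_ne_zero one_ne_zero h1
  · rw [baseChange_map (perpOneDim_perpMap p F⸨X⸩ (-laurentVar F) hf), hr]

theorem exists_rational_of_isIsotropic
    (hP : algebraMap (MvPolynomial (Fin n) F) (FractionRing (MvPolynomial (Fin n) F))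
      (toPolynomial p b) ≠ 0)
    [FiniteDimensional F W] (hq : q.Anisotropic)
    (h : IsIsotropic ((perpOneDim q F⸨X⸩ (-laurentVar F)).baseChange
      (QuadricField p b))) :
    ∃ y, q.baseChange (FractionRing (MvPolynomial (Fin n) F)) y =
      algebraMap (MvPolynomial (Fin n) F) _ (toPolynomial p b) := by
  obtain ⟨bq, hbq⟩ := LinearMap.BilinForm.exists_orthogonal_basis
    (QuadraticForm.associated_isSymm F q)
  by_contra! hcon
  have h1 := ((isAnisotropicDiag_of_isOrtho hbq hq).rational n).sum_laurent (fun y hy => hcon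
    (∑ i, y i ⊗ₜ[F] bq i) (by rw [baseChange_sum_tmul_of_isOrtho hbq, hy]))
  -- Anisotropy over F(X)((t)) descends to the coordinate ring along the embedding, and clearing
  -- denominators carries it to the function field.
  have h2 : IsAnisotropicDiag fun o =>
      algebraMap F⸨X⸩ (QuadricRing p b)
        (perpOneDim q F⸨X⸩ (-laurentVar F) (perpBasis bq F⸨X⸩ o)) := by
    refine IsAnisotropicDiag.of_map (quadricEmbedding hP) (quadricEmbedding_injective hP) ?_
    convert h1 using 1
    have e : ∀ r : F⸨X⸩, quadricEmbedding hP (algebraMap F⸨X⸩ (QuadricRing p b) r) =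
        laurentSubst (algebraMap F _) _ hP r := fun r =>
      (Ideal.Quotient.lift_mk _ _ _).trans (by simp [quadricEval])
    funext o
    rw [e]
    rcases o with o | o
    · rw [perpOneDim_perpBasis_inl, laurentSubst_algebraMap]
      rfl
    · rw [perpOneDim_perpBasis_inr, map_neg, laurentSubst_laurentVar]
      rfl
  have h3 := h2.fractionRing (QuadricField p b)
  obtain ⟨z, hz0, hz⟩ := h
  obtain ⟨r, rfl⟩ := exists_eq_sum_tmul (perpBasis bq F⸨X⸩) (QuadricField p b) z
  rw [baseChange_sum_tmul_of_isOrtho (isOrtho_perpBasis F⸨X⸩ _ hbq)] at hz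
  refine hz0 ?_
  rw [h3 r hz]
  simp

end FunctionField

/-! ### Value sets over extensions, and the equivalence of the four conditions -/

theorem representedValues_subset_of_isometry {F : Type*} [Field F] [Invertible (2 : F)]
    {V W : Type*} [AddCommGroup V] [Module F V] [AddCommGroup W] [Module F W]
    {p : QuadraticForm F V} {q : QuadraticForm F W} {f : V →ₗ[F] W} (hf : ∀ v, q (f v) = p v)
    (K : Type*) [Field K] [Algebra F K] :
    representedValues (p.baseChange K) ⊆ representedValues (q.baseChange K) := by
  rintro a ⟨ha, v, hv⟩
  exact ⟨ha, f.baseChange K v, by rw [baseChange_map hf, hv]⟩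

/-- If `D_K(p) ⊆ D_K(q)` for an extension `K` of the rational function field, isomorphic to it up
to a change of universe, then `q` represents the generic value of `p`. -/
theorem exists_rational_of_representedValues {F : Type u} [Field F] [Invertible (2 : F)]
    {V : Type v} {W : Type w} [AddCommGroup V] [Module F V] [AddCommGroup W] [Module F W]
    [FiniteDimensional F W] {p : QuadraticForm F V} {q : QuadraticForm F W} {n : ℕ}
    (b : Module.Basis (Fin n) F V) (hb : toPolynomial p b ≠ 0)
    (h : representedValues (p.baseChange (ULift.{t} (FractionRing (MvPolynomial (Fin n) F)))) ⊆
      representedValues (q.baseChange (ULift.{t} (FractionRing (MvPolynomial (Fin n) F))))) :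
    ∃ y, q.baseChange (FractionRing (MvPolynomial (Fin n) F)) y =
      algebraMap (MvPolynomial (Fin n) F) _ (toPolynomial p b) := by
  let R := MvPolynomial (Fin n) F
  let K := FractionRing R
  let e : ULift.{t} K ≃ₐ[F] K := ULift.algEquiv
  have hR : ∀ g : R, MvPolynomial.aeval (fun i => e.symm (algebraMap R K (MvPolynomial.X i))) g =
      e.symm (algebraMap R K g) := by
    have h1 : MvPolynomial.aeval (fun i => e.symm (algebraMap R K (MvPolynomial.X i))) =
        (e.symm : K →ₐ[F] ULift.{t} K).comp (IsScalarTower.toAlgHom F R K) :=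
      MvPolynomial.algHom_ext fun i => by simp [R]
    exact fun g => congrArg (· g) h1
  have h0 : e.symm (algebraMap R K (toPolynomial p b)) ≠ 0 := fun h0 => hb
    ((map_eq_zero_iff _ (IsFractionRing.injective R K)).mp
      ((map_eq_zero_iff _ e.symm.injective).mp h0))
  -- The lifted generic value is represented by `p` at the generic vector, hence also by `q`.
  obtain ⟨-, y, hy⟩ := h ⟨h0, ∑ i, e.symm (algebraMap R K (MvPolynomial.X i)) ⊗ₜ[F] b i,
    (baseChange_sum_tmul p b _ _).trans (hR _)⟩
  obtain ⟨r, rfl⟩ := exists_eq_sum_tmul (Module.finBasis F W) _ y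
  refine ⟨∑ j, e (r j) ⊗ₜ[F] Module.finBasis F W j, ?_⟩
  rw [baseChange_sum_tmul] at hy ⊢
  have h2 := congrArg e hy
  rw [e.apply_symm_apply] at h2
  rw [← h2]
  exact (MvPolynomial.comp_aeval_apply _ (e : ULift.{t} K →ₐ[F] K) _).symm

end QuadForms

end

theorem mainTheorem3 {F : Type u} [Field F] [Invertible (2 : F)]
    {V : Type v} [AddCommGroup V] [Module F V]
    {W : Type w} [AddCommGroup W] [Module F W] [FiniteDimensional F W]
    (p : QuadraticForm F V) (q : QuadraticForm F W)
    (hp : p.Anisotropic) (hq : q.Anisotropic)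
    {n : ℕ} (hn : 1 ≤ n) (b : Module.Basis (Fin n) F V) :
    List.TFAE [
      QuadForms.IsSubform p q,
      ∀ (K : Type (max u t)) [Field K] [Algebra F K],
        QuadForms.representedValues (p.baseChange K) ⊆
          QuadForms.representedValues (q.baseChange K),
      algebraMap (MvPolynomial (Fin n) F) (FractionRing (MvPolynomial (Fin n) F))
          (QuadForms.toPolynomial p b) ∈
        QuadForms.representedValues (q.baseChange (FractionRing (MvPolynomial (Fin n) F))),
      QuadForms.IsIsotropic
        ((QuadForms.perpOneDim q F⸨X⸩ (-QuadForms.laurentVar F)).baseChange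
          (QuadForms.FunctionField (QuadForms.perpOneDim p F⸨X⸩ (-QuadForms.laurentVar F))
            (QuadForms.perpBasis b F⸨X⸩)))] := by

  have hp0 := QuadForms.toPolynomial_ne_zero hn hp b
  have hP : algebraMap (MvPolynomial (Fin n) F) (FractionRing (MvPolynomial (Fin n) F))
      (QuadForms.toPolynomial p b) ≠ 0 := fun h =>
    hp0 ((map_eq_zero_iff _ (IsFractionRing.injective _ _)).mp h)
  tfae_have 1 → 2 := fun h K _ _ => by
    obtain ⟨f, hf⟩ := QuadForms.exists_isometry_of_isSubform h
    exact QuadForms.representedValues_subset_of_isometry hf K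
  tfae_have 2 → 3 := fun h =>
    -- A single extension suffices: the rational function field, lifted into the universe over which
    -- K ranges.
    ⟨hP, QuadForms.exists_rational_of_representedValues.{u, v, w, t} b hp0 (h _)⟩
  tfae_have 3 → 1 := fun h => QuadForms.isSubform_of_rational hp hq b h.2
  tfae_have 1 → 4 := fun h => by
    obtain ⟨f, hf⟩ := QuadForms.exists_isometry_of_isSubform h
    exact QuadForms.isIsotropic_of_isometry hP hf
  tfae_have 4 → 3 := fun h => ⟨hP, QuadForms.exists_rational_of_isIsotropic hP hq h⟩
  tfae_finish
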